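/- Let $M_+(\mathbb{R})$ be the set of real Radon measures on $\mathbb{R}$ (distributions of order zero, possibly of infinite total variation) whose support is bounded on the left; it is a commutative ring under addition and convolution $*$, with unit $\delta_0$. Let $M(\mathbb{R}_-)\subset M_+(\mathbb{R})$ be the set of those with compact support contained in $\mathbb{R}_-=(-\infty,0]$. For $\alpha\in M_+(\mathbb{R})$ put $l(\alpha)=\inf\operatorname{supp}\alpha$, and let $\pi(\alpha)$ be the restriction of $\alpha$ to the test functions $\psi\in C_c^\infty(\mathbb{R})$ with $\operatorname{supp}\psi\subset[0,+\infty)$. Products and determinants of matrices over $M_+(\mathbb{R})$ are taken in the convolution sense. Let $1\le q<+\infty$. Let $\Omega_q$ be the space of functions in $L^q(\mathbb{R},\mathbb{R})$ with compact support contained in $\mathbb{R}_-$, and let $\Gamma_q=L^q_{\rm loc}([0,+\infty),\mathbb{R})$ with convergence in $L^q$ on each compact set; elements of $\Gamma_q$ are extended by zero to negative times, and functions $f$ are identified with the measures $f\,dt$. Let $\Sigma^Q$ be a pseudo-rational system of order zero, i.e. let $Q$ and $P$ be $d\times d$ and $d\times m$ matrices with entries in $M(\mathbb{R}_-)$ such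 that $Q$ has an inverse $Q^{-1}$ with entries in $M_+(\mathbb{R})$, the input $u\in(\Omega_q)^m$ producing the output $\pi(Q^{-1}*P*u)\in(\Gamma_q)^d$. Put $X^{Q,q}=\{y\in(\Gamma_q)^d : \pi(Q*y)=0\}$. The system is called - $X^{Q,q}$ reachable if for every $y\in X^{Q,q}$ there is $u\in(\Omega_q)^m$ with $\pi(Q^{-1}*P*u)=y$; - $X^{Q,q}$ quasi-reachable if for every $y\in X^{Q,q}$ there is a sequence $(u_n)$ in $(\Omega_q)^m$ with $\pi(Q^{-1}*P*u_n)\to y$ in $(\Gamma_q)^d$; - $X^{Q,q}$ reachable (resp. quasi-reachable) in time $T$ if moreover $u$ (resp. every $u_n$) can be chosen with support in $[-T,0]$. **Theorem.** $\Sigma^Q$ is $X^{Q,q}$ quasi-reachable (resp. reachable) if and only if it is $X^{Q,q}$ quasi-reachable (resp. reachable) in time $T$ for all $T>-l(\det Q)$. In particular, if $\Sigma^Q$ is $X^{Q,q}$ quasi-reachable (resp. reachable), then the minimal time of quasi-reachability (resp. reachability), i.e. the infimum of the $T>0$ such that $\Sigma^Q$ is $X^{Q,q}$ quasi-reachable (resp.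 reachable) in time $T$, is at most $-l(\det Q)$. -/

import Mathlib

open MeasureTheory Set Filter Topology
open scoped ENNReal Distributions

noncomputable section

namespace PseudoRational

/-! ### Radon measures on the line with support bounded on the left -/

/-- Positive Radon measures on `ℝ` whose support is bounded on the left. -/
structure PosRadon where
  val : Measure ℝ
  locallyFinite : IsLocallyFiniteMeasure val
  bddLeft : ∃ a : ℝ, val (Iio a) = 0

namespace PosRadon

instance (μ : PosRadon) : IsLocallyFiniteMeasure μ.1 := μ.locallyFinite

theorem ext {μ ν : PosRadon} (h : μ.1 = ν.1) : μ = ν := by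
  cases μ; cases ν; cases h; rfl

theorem locallyFinite_of_Iic {μ : Measure ℝ} (h : ∀ c : ℝ, μ (Iic c) < ∞) :
    IsLocallyFiniteMeasure μ :=
  ⟨fun x => ⟨Iic (x + 1), Iic_mem_nhds (by linarith), h _⟩⟩

theorem Iic_lt_top (μ : PosRadon) (c : ℝ) : μ.1 (Iic c) < ∞ := by
  obtain ⟨a, ha⟩ := μ.bddLeft
  have hsub : Iic c ⊆ Iio a ∪ Icc a c := by
    intro x hx
    rcases lt_or_ge x a with h | h
    · exact Or.inl h
    · exact Or.inr ⟨h, hx⟩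
  calc μ.1 (Iic c) ≤ μ.1 (Iio a ∪ Icc a c) := measure_mono hsub
    _ ≤ μ.1 (Iio a) + μ.1 (Icc a c) := measure_union_le _ _
    _ < ∞ := by rw [ha, zero_add]; exact isCompact_Icc.measure_lt_top

theorem conv_Iio (μ ν : PosRadon) : ∃ a : ℝ, (μ.1.conv ν.1) (Iio a) = 0 := by
  obtain ⟨a, ha⟩ := μ.bddLeft
  obtain ⟨b, hb⟩ := ν.bddLeft
  refine ⟨a + b, ?_⟩
  rw [Measure.conv, Measure.map_apply (by fun_prop) measurableSet_Iio]
  have hsub : (fun x : ℝ × ℝ => x.1 + x.2) ⁻¹' Iio (a + b)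
      ⊆ (Iio a ×ˢ univ) ∪ (univ ×ˢ Iio b) := by
    rintro ⟨x, y⟩ h
    simp only [mem_preimage, mem_Iio, mem_union, mem_prod, mem_univ, and_true, true_and] at h ⊢
    by_contra hc
    push Not at hc
    linarith [hc.1, hc.2]
  refine measure_mono_null hsub (measure_union_null ?_ ?_)
  · rw [Measure.prod_prod, ha, zero_mul]
  · rw [Measure.prod_prod, hb, mul_zero]

theorem conv_Iic (μ ν : PosRadon) (c : ℝ) : (μ.1.conv ν.1) (Iic c) < ∞ := by
  obtain ⟨a, ha⟩ := μ.bddLeft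
  obtain ⟨b, hb⟩ := ν.bddLeft
  rw [Measure.conv, Measure.map_apply (by fun_prop) measurableSet_Iic]
  have hsub : (fun x : ℝ × ℝ => x.1 + x.2) ⁻¹' Iic c
      ⊆ ((Iio a ×ˢ univ) ∪ (univ ×ˢ Iio b)) ∪ (Iic (c - b) ×ˢ Iic (c - a)) := by
    rintro ⟨x, y⟩ h
    simp only [mem_preimage, mem_Iic, mem_Iio, mem_union, mem_prod, mem_univ, and_true,
      true_and] at h ⊢
    by_contra hc
    push Not at hc
    obtain ⟨⟨h1, h2⟩, h3⟩ := hc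
    linarith [h3 (by linarith)]
  refine (measure_mono hsub).trans_lt ((measure_union_le _ _).trans_lt ?_)
  have h0 : (μ.1.prod ν.1) ((Iio a ×ˢ univ) ∪ (univ ×ˢ Iio b)) = 0 := by
    refine measure_union_null ?_ ?_
    · rw [Measure.prod_prod, ha, zero_mul]
    · rw [Measure.prod_prod, hb, mul_zero]
  rw [h0, zero_add, Measure.prod_prod]
  exact ENNReal.mul_lt_top (μ.Iic_lt_top _) (ν.Iic_lt_top _)

instance : Zero PosRadon := ⟨⟨0, inferInstance, 0, by simp⟩⟩

/-- The Dirac mass at the origin is the unit for convolution. -/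
instance : One PosRadon := ⟨⟨Measure.dirac 0, inferInstance, 0, by simp⟩⟩

instance : Add PosRadon :=
  ⟨fun μ ν => ⟨μ.1 + ν.1,
    locallyFinite_of_Iic fun c => by
      rw [Measure.add_apply]
      exact ENNReal.add_lt_top.2 ⟨μ.Iic_lt_top c, ν.Iic_lt_top c⟩,
    by
      obtain ⟨a, ha⟩ := μ.bddLeft
      obtain ⟨b, hb⟩ := ν.bddLeft
      refine ⟨min a b, ?_⟩
      rw [Measure.add_apply,
        measure_mono_null (Iio_subset_Iio (min_le_left a b)) ha,
        measure_mono_null (Iio_subset_Iio (min_le_right a b)) hb, add_zero]⟩⟩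

/-- The product is the convolution of measures. -/
instance : Mul PosRadon :=
  ⟨fun μ ν => ⟨μ.1.conv ν.1, locallyFinite_of_Iic (conv_Iic μ ν), conv_Iio μ ν⟩⟩

theorem val_zero : (0 : PosRadon).1 = 0 := rfl
theorem val_one : (1 : PosRadon).1 = Measure.dirac 0 := rfl
theorem val_add (μ ν : PosRadon) : (μ + ν).1 = μ.1 + ν.1 := rfl
theorem val_mul (μ ν : PosRadon) : (μ * ν).1 = μ.1.conv ν.1 := rfl

instance : CommSemiring PosRadon where
  add_assoc a b c := ext (by simp only [val_add, add_assoc])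
  zero_add a := ext (by simp only [val_add, val_zero, zero_add])
  add_zero a := ext (by simp only [val_add, val_zero, add_zero])
  add_comm a b := ext (by simp only [val_add, add_comm])
  nsmul := nsmulRec
  left_distrib a b c := ext (by simp only [val_add, val_mul, Measure.conv_add])
  right_distrib a b c := ext (by simp only [val_add, val_mul, Measure.add_conv])
  zero_mul a := ext (by simp only [val_mul, val_zero, Measure.zero_conv])
  mul_zero a := ext (by simp only [val_mul, val_zero, Measure.conv_zero])
  mul_assoc a b c := ext (by simp only [val_mul, Measure.conv_assoc])
  one_mul a := ext (by simp only [val_mul, val_one, Measure.dirac_zero_conv])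
  mul_one a := ext (by simp only [val_mul, val_one, Measure.conv_dirac_zero])
  mul_comm a b := ext (by simp only [val_mul, Measure.conv_comm a.1 b.1])

theorem add_cancel {a b c : PosRadon} (h : a + c = b + c) : a = b := by
  have h' : a.1 + c.1 = b.1 + c.1 := congrArg PosRadon.val h
  refine ext (Measure.ext_of_Ioc _ _ fun x y _ => ?_)
  have hx : a.1 (Ioc x y) + c.1 (Ioc x y) = b.1 (Ioc x y) + c.1 (Ioc x y) := by
    rw [← Measure.add_apply, h', Measure.add_apply]
  exact (ENNReal.add_left_inj measure_Ioc_lt_top.ne).1 hx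

end PosRadon

/-- Two formal differences `a.1 - a.2` and `b.1 - b.2` of positive Radon measures define the same
signed Radon measure when `a.1 + b.2 = b.1 + a.2`. -/
instance diffSetoid : Setoid (PosRadon × PosRadon) where
  r a b := a.1 + b.2 = b.1 + a.2
  iseqv :=
    { refl := fun _ => rfl
      symm := fun h => h.symm
      trans := by
        intro a b c h1 h2
        refine PosRadon.add_cancel (c := b.2) ?_
        calc a.1 + c.2 + b.2 = (a.1 + b.2) + c.2 := by ring
          _ = (b.1 + c.2) + a.2 := by rw [h1]; ring
          _ = c.1 + a.2 + b.2 := by rw [h2]; ring }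

theorem diff_equiv_iff {a b : PosRadon × PosRadon} : a ≈ b ↔ a.1 + b.2 = b.1 + a.2 := Iff.rfl

/-- `M₊(ℝ)`: real (signed) Radon measures on `ℝ`, possibly of infinite total variation, with
support bounded on the left, that is, distributions of order zero with such support. They are
represented as differences of positive ones. -/
def MPlus : Type := Quotient diffSetoid

namespace MPlus

/-- The signed Radon measure `μ - ν`. -/
def mk (μ ν : PosRadon) : MPlus := Quotient.mk diffSetoid (μ, ν)

theorem mk_eq {a b c d : PosRadon} (h : a + d = c + b) : mk a b = mk c d :=
  Quotient.sound (s := diffSetoid) h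

instance : Zero MPlus := ⟨mk 0 0⟩

/-- The unit is the Dirac mass `δ₀`. -/
instance : One MPlus := ⟨mk 1 0⟩

instance : Neg MPlus :=
  ⟨Quotient.lift (fun a => mk a.2 a.1) fun a b h => mk_eq (by
    have h : a.1 + b.2 = b.1 + a.2 := h
    rw [add_comm a.2, add_comm b.2]; exact h.symm)⟩

instance : Add MPlus :=
  ⟨Quotient.lift₂ (fun a b => mk (a.1 + b.1) (a.2 + b.2)) fun a b c d h1 h2 => mk_eq (by
    have h1 : a.1 + c.2 = c.1 + a.2 := h1
    have h2 : b.1 + d.2 = d.1 + b.2 := h2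
    calc a.1 + b.1 + (c.2 + d.2) = (a.1 + c.2) + (b.1 + d.2) := by ring
      _ = c.1 + d.1 + (a.2 + b.2) := by rw [h1, h2]; ring)⟩

/-- The product is the convolution, extended from positive measures by bilinearity. -/
instance : Mul MPlus :=
  ⟨Quotient.lift₂
    (fun a b => mk (a.1 * b.1 + a.2 * b.2) (a.1 * b.2 + a.2 * b.1)) fun a b c d h1 h2 => by
    have h1 : a.1 + c.2 = c.1 + a.2 := h1
    have h2 : b.1 + d.2 = d.1 + b.2 := h2
    refine mk_eq (PosRadon.add_cancel (c := c.2 * b.1 + c.1 * b.2) ?_)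
    calc a.1 * b.1 + a.2 * b.2 + (c.1 * d.2 + c.2 * d.1) + (c.2 * b.1 + c.1 * b.2)
        = (a.1 + c.2) * b.1 + (c.1 + a.2) * b.2 + c.1 * d.2 + c.2 * d.1 := by ring
      _ = (c.1 + a.2) * b.1 + (a.1 + c.2) * b.2 + c.1 * d.2 + c.2 * d.1 := by rw [h1]
      _ = a.2 * b.1 + a.1 * b.2 + (c.1 * (b.1 + d.2) + c.2 * (d.1 + b.2)) := by ring
      _ = a.2 * b.1 + a.1 * b.2 + (c.1 * (d.1 + b.2) + c.2 * (b.1 + d.2)) := by rw [h2]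
      _ = c.1 * d.1 + c.2 * d.2 + (a.1 * b.2 + a.2 * b.1) + (c.2 * b.1 + c.1 * b.2) := by ring⟩

theorem mk_add_mk (a b c d : PosRadon) : mk a b + mk c d = mk (a + c) (b + d) := rfl
theorem mk_mul_mk (a b c d : PosRadon) :
    mk a b * mk c d = mk (a * c + b * d) (a * d + b * c) := rfl
theorem neg_mk (a b : PosRadon) : -mk a b = mk b a := rfl
theorem zero_def : (0 : MPlus) = mk 0 0 := rfl
theorem one_def : (1 : MPlus) = mk 1 0 := rfl

theorem ind {p : MPlus → Prop} (h : ∀ a b, p (mk a b)) (x : MPlus) : p x :=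
  Quotient.inductionOn x fun a => h a.1 a.2

instance : CommRing MPlus where
  add_assoc := by
    refine ind fun a b => ind fun c d => ind fun e f => ?_
    simp only [mk_add_mk, add_assoc]
  zero_add := by
    refine ind fun a b => ?_
    simp only [mk_add_mk, zero_def, zero_add]
  add_zero := by
    refine ind fun a b => ?_
    simp only [mk_add_mk, zero_def, add_zero]
  add_comm := by
    refine ind fun a b => ind fun c d => ?_
    simp only [mk_add_mk, add_comm]
  nsmul := nsmulRec
  zsmul := zsmulRec
  neg_add_cancel := by
    refine ind fun a b => ?_
    rw [neg_mk, mk_add_mk, zero_def]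
    exact mk_eq (by ring)
  left_distrib := by
    refine ind fun a b => ind fun c d => ind fun e f => ?_
    simp only [mk_add_mk, mk_mul_mk]
    exact mk_eq (by ring)
  right_distrib := by
    refine ind fun a b => ind fun c d => ind fun e f => ?_
    simp only [mk_add_mk, mk_mul_mk]
    exact mk_eq (by ring)
  zero_mul := by
    refine ind fun a b => ?_
    simp only [zero_def, mk_mul_mk]
    exact mk_eq (by ring)
  mul_zero := by
    refine ind fun a b => ?_
    simp only [zero_def, mk_mul_mk]
    exact mk_eq (by ring)
  mul_assoc := by
    refine ind fun a b => ind fun c d => ind fun e f => ?_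
    simp only [mk_mul_mk]
    exact mk_eq (by ring)
  one_mul := by
    refine ind fun a b => ?_
    simp only [one_def, mk_mul_mk]
    exact mk_eq (by ring)
  mul_one := by
    refine ind fun a b => ?_
    simp only [one_def, mk_mul_mk]
    exact mk_eq (by ring)
  mul_comm := by
    refine ind fun a b => ind fun c d => ?_
    simp only [mk_mul_mk]
    exact mk_eq (by ring)

theorem integrable_test (μ : PosRadon) (ψ : 𝓓((⊤ : TopologicalSpace.Opens ℝ), ℝ)) :
    Integrable (fun t => ψ t) μ.1 :=
  ψ.continuous.integrable_of_hasCompactSupport ψ.hasCompactSupport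

/-- The duality pairing `⟨α, ψ⟩` of a signed Radon measure with a test function. -/
def pairing (α : MPlus) (ψ : 𝓓((⊤ : TopologicalSpace.Opens ℝ), ℝ)) : ℝ :=
  Quotient.lift
    (fun a : PosRadon × PosRadon => ∫ t, ψ t ∂a.1.1 - ∫ t, ψ t ∂a.2.1)
    (fun a b h => by
      have h : a.1 + b.2 = b.1 + a.2 := h
      have h' : a.1.1 + b.2.1 = b.1.1 + a.2.1 := congrArg PosRadon.val h
      have e : ∫ t, ψ t ∂(a.1.1 + b.2.1) = ∫ t, ψ t ∂(b.1.1 + a.2.1) := by rw [h']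
      rw [integral_add_measure (integrable_test _ ψ) (integrable_test _ ψ),
        integral_add_measure (integrable_test _ ψ) (integrable_test _ ψ)] at e
      change ∫ t, ψ t ∂a.1.1 - ∫ t, ψ t ∂a.2.1 = ∫ t, ψ t ∂b.1.1 - ∫ t, ψ t ∂b.2.1
      linarith) α

/-- The support of `α` as a distribution. -/
def supp (α : MPlus) : Set ℝ := Distribution.dsupport α.pairing

/-- `l(α) = inf supp α`, in the extended real line. -/
def l (α : MPlus) : EReal := sInf ((fun x : ℝ => (x : EReal)) '' α.supp)

/-- `α ∈ M(ℝ₋)`: the support of `α` is compact and contained in `(-∞, 0]`. -/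
def InMNeg (α : MPlus) : Prop := IsCompact α.supp ∧ α.supp ⊆ Iic 0

/-- `π(α) = π(β)`: `α` and `β` agree on all test functions with support in `[0, ∞)`. -/
def PiEq (α β : MPlus) : Prop :=
  ∀ ψ : 𝓓((⊤ : TopologicalSpace.Opens ℝ), ℝ), tsupport ψ ⊆ Ici 0 → α.pairing ψ = β.pairing ψ

end MPlus

/-! ### Functions as Radon measures -/

/-- The positive Radon measure with density `f⁺`. -/
def posDensity (f : ℝ → ℝ) (hf : LocallyIntegrable f volume)
    (ha : ∃ a : ℝ, ∀ᵐ t : ℝ, t < a → f t = 0) : PosRadon :=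
  { val := volume.withDensity fun t => ENNReal.ofReal (f t)
    locallyFinite := by
      refine ⟨fun x => ?_⟩
      obtain ⟨s, hs, hint⟩ := hf x
      obtain ⟨U, hU, hUo, hxU⟩ := mem_nhds_iff.1 hs
      refine ⟨U, hUo.mem_nhds hxU, ?_⟩
      rw [withDensity_apply _ hUo.measurableSet]
      refine lt_of_le_of_lt (lintegral_mono fun t => ?_) (hint.mono_set hU).2
      exact Real.ofReal_le_enorm _
    bddLeft := by
      obtain ⟨a, ha⟩ := ha
      refine ⟨a, ?_⟩
      rw [withDensity_apply _ measurableSet_Iio]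
      have : ∀ᵐ t ∂(volume.restrict (Iio a)), ENNReal.ofReal (f t) = 0 := by
        rw [ae_restrict_iff' measurableSet_Iio]
        filter_upwards [ha] with t ht hta
        rw [ht hta, ENNReal.ofReal_zero]
      rw [lintegral_congr_ae this, lintegral_zero] }

/-- A locally integrable function with support bounded on the left, viewed as the Radon measure
`f dt = f⁺ dt - f⁻ dt`. -/
def ofFun (f : ℝ → ℝ) (hf : LocallyIntegrable f volume)
    (ha : ∃ a : ℝ, ∀ᵐ t : ℝ, t < a → f t = 0) : MPlus :=
  MPlus.mk (posDensity f hf ha)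
    (posDensity (fun t => -f t) hf.neg (by
      obtain ⟨a, ha⟩ := ha
      exact ⟨a, ha.mono fun t ht hta => by rw [ht hta, neg_zero]⟩))

/-- `Ω_q`: functions in `L^q(ℝ)` with compact support contained in `(-∞, 0]`. -/
structure InputFn (q : ℝ≥0∞) where
  toFun : ℝ → ℝ
  memLp : MemLp toFun q volume
  supported : ∃ N : ℕ, ∀ᵐ t : ℝ, t ∉ Icc (-(N : ℝ)) 0 → toFun t = 0

/-- `Γ_q = L^q_loc([0, ∞))`, its elements being extended by zero to negative times. -/
structure OutputFn (q : ℝ≥0∞) where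
  toFun : ℝ → ℝ
  memLp : ∀ K : Set ℝ, IsCompact K → MemLp toFun q (volume.restrict K)
  eq_zero : ∀ t < 0, toFun t = 0

/-- An input as a Radon measure. -/
def InputFn.toMPlus {q : ℝ≥0∞} [hq : Fact (1 ≤ q)] (u : InputFn q) : MPlus :=
  ofFun u.toFun (u.memLp.locallyIntegrable hq.out) (by
    obtain ⟨N, hN⟩ := u.supported
    exact ⟨-(N : ℝ), hN.mono fun t ht hlt => ht fun h => absurd h.1 (not_le.2 hlt)⟩)

/-- An output as a Radon measure. -/
def OutputFn.toMPlus {q : ℝ≥0∞} [hq : Fact (1 ≤ q)] (y : OutputFn q) : MPlus :=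
  ofFun y.toFun
    (locallyIntegrable_iff.2 fun K hK => by
      have : IsFiniteMeasure (volume.restrict K) :=
        ⟨by rw [Measure.restrict_apply_univ]; exact hK.measure_lt_top⟩
      exact (y.memLp K hK).integrable hq.out)
    ⟨0, Eventually.of_forall y.eq_zero⟩

/-- The support of the input `u` is contained in `[-T, 0]`. -/
def InputFn.SupportedIn {q : ℝ≥0∞} (u : InputFn q) (T : ℝ) : Prop :=
  ∀ᵐ t : ℝ, t ∉ Icc (-T) 0 → u.toFun t = 0

/-! ### Pseudo-rational systems of order zero -/

/-- A pseudo-rational system of order zero: matrices `Q` and `P` over `M(ℝ₋)` such that `Q` has a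
convolution inverse over `M₊(ℝ)`. Matrix products are convolution products. -/
structure System (d m : ℕ) where
  Q : Matrix (Fin d) (Fin d) MPlus
  P : Matrix (Fin d) (Fin m) MPlus
  Qinv : Matrix (Fin d) (Fin d) MPlus
  Q_mem : ∀ i j, (Q i j).InMNeg
  P_mem : ∀ i j, (P i j).InMNeg
  Qinv_mul : Qinv * Q = 1
  mul_Qinv : Q * Qinv = 1

namespace System

variable {d m : ℕ}

/-- The impulse response matrix `A = Q⁻¹ * P`. -/
def A (S : System d m) : Matrix (Fin d) (Fin m) MPlus := S.Qinv * S.P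

/-- `π(A * u) = y`. -/
def IsOutput (S : System d m) {q : ℝ≥0∞} [Fact (1 ≤ q)]
    (u : Fin m → InputFn q) (y : Fin d → OutputFn q) : Prop :=
  ∀ i, (S.A.mulVec (fun j => (u j).toMPlus) i).PiEq (y i).toMPlus

/-- The state space `X^{Q,q} = {y ∈ (Γ_q)^d | π(Q * y) = 0}`. -/
def X (S : System d m) (q : ℝ≥0∞) [Fact (1 ≤ q)] : Set (Fin d → OutputFn q) :=
  {y | ∀ i, (S.Q.mulVec (fun j => (y j).toMPlus) i).PiEq 0}

/-- Convergence of a sequence of outputs in `(L^q_loc([0, ∞)))^d`. -/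
def TendstoOutput {q : ℝ≥0∞} (z : ℕ → Fin d → OutputFn q) (y : Fin d → OutputFn q) : Prop :=
  ∀ i, ∀ K : Set ℝ, IsCompact K →
    Tendsto (fun n => eLpNorm (fun t => (z n i).toFun t - (y i).toFun t) q (volume.restrict K))
      atTop (𝓝 0)

/-- `X^{Q,q}` quasi-reachability. -/
def QuasiReachable (S : System d m) (q : ℝ≥0∞) [Fact (1 ≤ q)] : Prop :=
  ∀ y ∈ S.X q, ∃ (u : ℕ → Fin m → InputFn q) (z : ℕ → Fin d → OutputFn q),
    (∀ n, S.IsOutput (u n) (z n)) ∧ TendstoOutput z y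

/-- `X^{Q,q}` quasi-reachability in time `T`. -/
def QuasiReachableIn (S : System d m) (q : ℝ≥0∞) [Fact (1 ≤ q)] (T : ℝ) : Prop :=
  ∀ y ∈ S.X q, ∃ (u : ℕ → Fin m → InputFn q) (z : ℕ → Fin d → OutputFn q),
    (∀ n j, (u n j).SupportedIn T) ∧ (∀ n, S.IsOutput (u n) (z n)) ∧ TendstoOutput z y

/-- `X^{Q,q}` reachability. -/
def Reachable (S : System d m) (q : ℝ≥0∞) [Fact (1 ≤ q)] : Prop :=
  ∀ y ∈ S.X q, ∃ u : Fin m → InputFn q, S.IsOutput u y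

/-- `X^{Q,q}` reachability in time `T`. -/
def ReachableIn (S : System d m) (q : ℝ≥0∞) [Fact (1 ≤ q)] (T : ℝ) : Prop :=
  ∀ y ∈ S.X q, ∃ u : Fin m → InputFn q, (∀ j, (u j).SupportedIn T) ∧ S.IsOutput u y

/-- The minimal time of quasi-reachability, `+∞` if there is no such time. -/
def quasiReachableMinTime (S : System d m) (q : ℝ≥0∞) [Fact (1 ≤ q)] : EReal :=
  ⨅ (T : ℝ) (_ : 0 < T ∧ S.QuasiReachableIn q T), (T : EReal)

/-- The minimal time of reachability, `+∞` if there is no such time. -/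
def reachableMinTime (S : System d m) (q : ℝ≥0∞) [Fact (1 ≤ q)] : EReal :=
  ⨅ (T : ℝ) (_ : 0 < T ∧ S.ReachableIn q T), (T : EReal)

end System

end PseudoRational

end

/-! Divide the input by `det Q`. Since `Q` is invertible, `det Q` has the convolution inverse `det
Qinv`. Cut `det Qinv * u = v + r` at the origin, with `v` carried by `(-∞, 0]` and `r` by `(0, ∞)`,
and put `u' = det Q * r`, so that `u = det Q * v + u'`. Both `u` and `det Q * v` live on `(-∞, 0]`,
hence so does `u'`; and `u'` lives on `[l(det Q), ∞)` because `r` lives on `(0, ∞)`. So `u'` is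
supported in `[-T, 0]` as soon as `-T ≤ l(det Q)`. Finally `A * u - A * u' = (det Q • A) * v =
adj(Q) * P * v` is carried by `(-∞, 0]`, which `π` does not see: `u` and `u'` produce the same
output.

Two analytic facts support this algebra. Distributional support controls where the measures are
carried (`MPlus.concentratedOn_of_supp_subset`), and convolution by an element of `M₊(ℝ)` preserves
local `L^q` densities (`PosRadon.HasLpDensity.mul`), so that `u'` is again an `L^q` function. -/

namespace PseudoRational

/-! ### Restrictions of positive measures and carriers of convolutions. -/

namespace PosRadon

/-- The restriction of a positive Radon measure to a set. -/
noncomputable def restrict (μ : PosRadon) (s : Set ℝ) : PosRadon where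
  val := μ.1.restrict s
  locallyFinite := locallyFinite_of_Iic fun c =>
    (Measure.restrict_le_self _).trans_lt (μ.Iic_lt_top c)
  bddLeft := μ.bddLeft.imp fun _ h => le_antisymm (h ▸ Measure.restrict_le_self _) zero_le

theorem val_restrict (μ : PosRadon) (s : Set ℝ) : (μ.restrict s).1 = μ.1.restrict s := rfl

theorem restrict_add_restrict_compl (μ : PosRadon) {s : Set ℝ} (hs : MeasurableSet s) :
    μ.restrict s + μ.restrict sᶜ = μ :=
  ext (Measure.restrict_add_restrict_compl hs)

theorem restrict_null (μ : PosRadon) {s : Set ℝ} (hs : MeasurableSet s) :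
    (μ.restrict s).1 sᶜ = 0 := by
  rw [val_restrict, Measure.restrict_apply hs.compl, compl_inter_self, measure_empty]

theorem restrict_eq_self {μ : PosRadon} {s : Set ℝ} (h : μ.1 sᶜ = 0) :
    μ.restrict s = μ :=
  ext (Measure.restrict_eq_self_of_ae_mem (mem_ae_iff.2 h))

theorem add_restrict (μ ν : PosRadon) (s : Set ℝ) :
    (μ + ν).restrict s = μ.restrict s + ν.restrict s :=
  ext (Measure.restrict_add _ _ _)

theorem mul_null {μ ν : PosRadon} {s t r : Set ℝ} (hμ : μ.1 sᶜ = 0) (hν : ν.1 tᶜ = 0)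
    (hr : MeasurableSet r) (h : ∀ x ∈ s, ∀ y ∈ t, x + y ∈ r) : (μ * ν).1 rᶜ = 0 := by
  rw [val_mul, Measure.conv, Measure.map_apply (by fun_prop) hr.compl]
  have hsub : (fun x : ℝ × ℝ => x.1 + x.2) ⁻¹' rᶜ ⊆ (sᶜ ×ˢ univ) ∪ (univ ×ˢ tᶜ) := by
    rintro ⟨x, y⟩ hxy
    by_contra hc
    simp only [mem_union, mem_prod, mem_compl_iff, mem_univ, and_true, true_and, not_or,
      not_not] at hc
    exact hxy (h x hc.1 y hc.2)
  refine measure_mono_null hsub (measure_union_null ?_ ?_)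
  · rw [Measure.prod_prod, hμ, zero_mul]
  · rw [Measure.prod_prod, hν, mul_zero]

end PosRadon

/-! ### Signed measures carried by a set. -/

namespace MPlus

/-- `α` is a difference of positive Radon measures carried by `s`. -/
def ConcentratedOn (α : MPlus) (s : Set ℝ) : Prop :=
  ∃ μ ν : PosRadon, α = mk μ ν ∧ μ.1 sᶜ = 0 ∧ ν.1 sᶜ = 0

theorem concentratedOn_of_restrict_compl_eq {μ ν : PosRadon} {s : Set ℝ} (hs : MeasurableSet s)
    (h : μ.1.restrict sᶜ = ν.1.restrict sᶜ) : ConcentratedOn (mk μ ν) s := by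
  refine ⟨μ.restrict s, ν.restrict s, mk_eq ?_, μ.restrict_null hs, ν.restrict_null hs⟩
  have h' : μ.restrict sᶜ = ν.restrict sᶜ := PosRadon.ext h
  conv_lhs => rw [← μ.restrict_add_restrict_compl hs, h']
  conv_rhs => rw [← ν.restrict_add_restrict_compl hs]
  ring

/-- A given representative may have mass off `s` that cancels in the difference. Restricting to `s`
the identity that equates it with a representative carried by `s` removes that mass. -/
theorem ConcentratedOn.mk_restrict {μ ν : PosRadon} {s : Set ℝ}
    (h : ConcentratedOn (mk μ ν) s) : mk μ ν = mk (μ.restrict s) (ν.restrict s) := by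
  obtain ⟨μ', ν', he, hμ', hν'⟩ := h
  rw [he]
  have h1 : μ + ν' = μ' + ν := Quotient.exact he
  have h2 := congrArg (PosRadon.restrict · s) h1
  simp only [PosRadon.add_restrict, PosRadon.restrict_eq_self hμ',
    PosRadon.restrict_eq_self hν'] at h2
  exact mk_eq h2.symm

theorem ConcentratedOn.neg {α : MPlus} {s : Set ℝ} (h : ConcentratedOn α s) :
    ConcentratedOn (-α) s := by
  obtain ⟨μ, ν, rfl, hμ, hν⟩ := h
  exact ⟨ν, μ, rfl, hν, hμ⟩

theorem ConcentratedOn.add {α β : MPlus} {s : Set ℝ} (hα : ConcentratedOn α s)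
    (hβ : ConcentratedOn β s) : ConcentratedOn (α + β) s := by
  obtain ⟨μ, ν, rfl, hμ, hν⟩ := hα
  obtain ⟨μ', ν', rfl, hμ', hν'⟩ := hβ
  refine ⟨μ + μ', ν + ν', rfl, ?_, ?_⟩
  · rw [PosRadon.val_add, Measure.add_apply, hμ, hμ', add_zero]
  · rw [PosRadon.val_add, Measure.add_apply, hν, hν', add_zero]

theorem ConcentratedOn.mul {α β : MPlus} {s t r : Set ℝ} (hα : ConcentratedOn α s)
    (hβ : ConcentratedOn β t) (hr : MeasurableSet r) (h : ∀ x ∈ s, ∀ y ∈ t, x + y ∈ r) :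
    ConcentratedOn (α * β) r := by
  obtain ⟨μ, ν, rfl, hμ, hν⟩ := hα
  obtain ⟨μ', ν', rfl, hμ', hν'⟩ := hβ
  refine ⟨_, _, mk_mul_mk _ _ _ _, ?_, ?_⟩
  · rw [PosRadon.val_add, Measure.add_apply, PosRadon.mul_null hμ hμ' hr h,
      PosRadon.mul_null hν hν' hr h, add_zero]
  · rw [PosRadon.val_add, Measure.add_apply, PosRadon.mul_null hμ hν' hr h,
      PosRadon.mul_null hν hμ' hr h, add_zero]

/-- The subring of the elements of `M₊(ℝ)` carried by `(-∞, 0]`. -/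
def nonposSubring : Subring MPlus where
  carrier := {α | ConcentratedOn α (Iic 0)}
  mul_mem' ha hb := ha.mul hb measurableSet_Iic fun x hx y hy => by
    simp only [mem_Iic] at *; linarith
  one_mem' := ⟨1, 0, rfl, by
    rw [PosRadon.val_one, Measure.dirac_apply' _ measurableSet_Iic.compl]; simp, by
    rw [PosRadon.val_zero]; simp⟩
  add_mem' ha hb := ha.add hb
  zero_mem' := ⟨0, 0, rfl, by rw [PosRadon.val_zero]; simp, by rw [PosRadon.val_zero]; simp⟩
  neg_mem' ha := ha.neg

theorem mem_nonposSubring {α : MPlus} : α ∈ nonposSubring ↔ ConcentratedOn α (Iic 0) :=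
  Iff.of_eq rfl

/-! ### Pairing with test functions, distributional support and `l`. -/

theorem pairing_mk (μ ν : PosRadon) (ψ : 𝓓((⊤ : TopologicalSpace.Opens ℝ), ℝ)) :
    (mk μ ν).pairing ψ = ∫ t, ψ t ∂μ.1 - ∫ t, ψ t ∂ν.1 := rfl

theorem pairing_add (α β : MPlus) (ψ : 𝓓((⊤ : TopologicalSpace.Opens ℝ), ℝ)) :
    (α + β).pairing ψ = α.pairing ψ + β.pairing ψ := by
  induction α using ind with | _ a b
  induction β using ind with | _ c d
  rw [mk_add_mk, pairing_mk, pairing_mk, pairing_mk, PosRadon.val_add, PosRadon.val_add,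
    integral_add_measure (integrable_test _ ψ) (integrable_test _ ψ),
    integral_add_measure (integrable_test _ ψ) (integrable_test _ ψ)]
  ring

theorem ConcentratedOn.pairing_eq_zero {α : MPlus} {s : Set ℝ} (h : ConcentratedOn α s)
    {ψ : 𝓓((⊤ : TopologicalSpace.Opens ℝ), ℝ)} (hψ : ∀ t ∈ s, ψ t = 0) : α.pairing ψ = 0 := by
  obtain ⟨μ, ν, rfl, hμ, hν⟩ := h
  have key : ∀ μ : PosRadon, μ.1 sᶜ = 0 → ∫ t, ψ t ∂μ.1 = 0 := fun μ hμ => by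
    have h0 : ∀ᵐ t ∂μ.1, t ∈ s := mem_ae_iff.2 hμ
    exact integral_eq_zero_of_ae (h0.mono hψ)
  rw [pairing_mk, key μ hμ, key ν hν, sub_zero]

theorem PiEq.of_sub_concentratedOn {α β γ : MPlus} (h : ConcentratedOn (β - α) (Iic 0))
    (hα : α.PiEq γ) : β.PiEq γ := by
  intro ψ hψ
  -- By continuity `ψ` also vanishes at `0`, so even an atom at the origin is invisible to `π`.
  have hz : ∀ t ∈ Iic (0 : ℝ), ψ t = 0 := by
    have hneg : ∀ t ∈ Iio (0 : ℝ), ψ t = 0 := fun t ht =>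
      image_eq_zero_of_notMem_tsupport fun hc => absurd (mem_Ici.1 (hψ hc)) (not_le.2 ht)
    have hcl : IsClosed {t : ℝ | ψ t = 0} := isClosed_eq ψ.continuous continuous_const
    have := hcl.closure_subset_iff.2 hneg
    rwa [closure_Iio] at this
  rw [← hα ψ hψ, ← sub_add_cancel β α, pairing_add, h.pairing_eq_zero hz, zero_add]

/-- Relative to the dominating measure `μ + ν`, the pairing is integration against a locally
integrable function, the difference of the two densities; the fundamental lemma of the calculus of
variations applies to it. -/
theorem ae_rnDeriv_eq_of_isVanishingOn {μ ν : PosRadon} {U : Set ℝ} (hU : IsOpen U)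
    (h : Distribution.IsVanishingOn (mk μ ν).pairing U) :
    ∀ᵐ x ∂(μ.1 + ν.1), x ∈ U →
      (μ.1.rnDeriv (μ.1 + ν.1) x).toReal - (ν.1.rnDeriv (μ.1 + ν.1) x).toReal = 0 := by
  set ρ := μ.1 + ν.1 with hρ
  have : IsLocallyFiniteMeasure ρ := (μ + ν).locallyFinite
  have hμ : μ.1 ≪ ρ := Measure.absolutelyContinuous_of_le (Measure.le_add_right le_rfl)
  have hν : ν.1 ≪ ρ := Measure.absolutelyContinuous_of_le (Measure.le_add_left le_rfl)
  have hint : ∀ μ : PosRadon, LocallyIntegrable (fun x => (μ.1.rnDeriv ρ x).toReal) ρ :=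
    fun μ => locallyIntegrable_iff.2 fun K hK =>
      Measure.integrableOn_toReal_rnDeriv hK.measure_lt_top.ne
  refine hU.ae_eq_zero_of_integral_contDiff_smul_eq_zero
    (((hint μ).sub (hint ν)).locallyIntegrableOn U) fun g hg hgc hgU => ?_
  let ψ : 𝓓((⊤ : TopologicalSpace.Opens ℝ), ℝ) := ⟨g, hg, hgc, fun _ _ => trivial⟩
  have h0 := h ψ hgU
  rw [pairing_mk] at h0
  change ∫ t, g t ∂μ.1 - ∫ t, g t ∂ν.1 = 0 at h0
  have hi : ∀ μ : PosRadon, μ.1 ≪ ρ → Integrable (fun x => (μ.1.rnDeriv ρ x).toReal • g x) ρ :=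
    fun μ hμ => (integrable_rnDeriv_smul_iff hμ).2 (integrable_test μ ψ)
  rw [← integral_rnDeriv_smul hμ, ← integral_rnDeriv_smul hν,
    ← integral_sub (hi μ hμ) (hi ν hν)] at h0
  rw [← h0]
  congr 1 with x
  simp only [smul_eq_mul]
  ring

/-- Each point off `C` has a neighbourhood where the densities of `μ` and `ν` agree almost
everywhere; a locally null set being null, the two measures coincide off `C` and cancel there. -/
theorem concentratedOn_of_supp_subset {α : MPlus} {C : Set ℝ} (hC : IsClosed C)
    (h : α.supp ⊆ C) : ConcentratedOn α C := by
  induction α using ind with | _ μ ν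
  refine concentratedOn_of_restrict_compl_eq hC.measurableSet ?_
  have hμ : μ.1 ≪ μ.1 + ν.1 :=
    Measure.absolutelyContinuous_of_le (Measure.le_add_right le_rfl)
  have hν : ν.1 ≪ μ.1 + ν.1 :=
    Measure.absolutelyContinuous_of_le (Measure.le_add_left le_rfl)
  have hnull : ∀ᵐ x ∂(μ.1 + ν.1), x ∈ Cᶜ →
      (μ.1.rnDeriv (μ.1 + ν.1) x).toReal - (ν.1.rnDeriv (μ.1 + ν.1) x).toReal = 0 := by
    rw [ae_iff]
    refine measure_null_of_locally_null _ fun x hx => ?_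
    have hxC : x ∉ C := fun hc => hx fun hc' => absurd hc hc'
    obtain ⟨U, hUv, hU, hxU⟩ :=
      (Distribution.notMem_dsupport_iff x).1 fun hs => hxC (h hs)
    refine ⟨_, inter_mem self_mem_nhdsWithin (mem_nhdsWithin_of_mem_nhds (hU.mem_nhds hxU)),
      measure_mono_null ?_ (ae_iff.1 (ae_rnDeriv_eq_of_isVanishingOn hU hUv))⟩
    rintro y ⟨hy, hyU⟩ hc
    exact hy fun _ => hc hyU
  rw [← Measure.withDensity_rnDeriv_eq _ _ hμ]
  conv_rhs => rw [← Measure.withDensity_rnDeriv_eq _ _ hν]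
  rw [restrict_withDensity hC.measurableSet.compl, restrict_withDensity hC.measurableSet.compl]
  refine withDensity_congr_ae ?_
  filter_upwards [(ae_restrict_iff' hC.measurableSet.compl).2 hnull,
    ae_restrict_of_ae (μ.1.rnDeriv_lt_top (μ.1 + ν.1)),
    ae_restrict_of_ae (ν.1.rnDeriv_lt_top (μ.1 + ν.1))] with x hx h1 h2
  exact (ENNReal.toReal_eq_toReal_iff' h1.ne h2.ne).1 (sub_eq_zero.1 hx)

theorem concentratedOn_Ici {α : MPlus} {c : ℝ} (h : (c : EReal) ≤ α.l) :
    ConcentratedOn α (Ici c) :=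
  concentratedOn_of_supp_subset isClosed_Ici fun x hx =>
    EReal.coe_le_coe_iff.1 (h.trans (sInf_le ⟨x, hx, rfl⟩))

/-- Ensures that real times `T > -l(det Q)` exist, without which the converse implications would
fail to follow. -/
theorem l_ne_bot (α : MPlus) : α.l ≠ ⊥ := by
  induction α using ind with | _ μ ν
  obtain ⟨a, ha⟩ := μ.bddLeft
  obtain ⟨b, hb⟩ := ν.bddLeft
  have hc : ConcentratedOn (mk μ ν) (Ici (min a b)) :=
    ⟨μ, ν, rfl, by
      rw [compl_Ici]; exact measure_mono_null (Iio_subset_Iio (min_le_left a b)) ha, by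
      rw [compl_Ici]; exact measure_mono_null (Iio_subset_Iio (min_le_right a b)) hb⟩
  have hle : ((min a b : ℝ) : EReal) ≤ (mk μ ν).l := by
    refine le_sInf ?_
    rintro _ ⟨x, hx, rfl⟩
    rw [EReal.coe_le_coe_iff]
    by_contra hlt
    refine (Distribution.notMem_dsupport_iff x).2
      ⟨Iio (min a b), fun ψ hψ => ?_, isOpen_Iio, not_le.1 hlt⟩ hx
    exact hc.pairing_eq_zero fun t ht =>
      image_eq_zero_of_notMem_tsupport fun hc => absurd (mem_Iio.1 (hψ hc)) (not_lt.2 ht)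
  exact ne_bot_of_le_ne_bot (EReal.coe_ne_bot _) hle

instance : Nontrivial MPlus := by
  refine ⟨0, 1, fun h => ?_⟩
  have h1 : (0 : PosRadon) + 0 = 1 + 0 := Quotient.exact h
  have h2 := congrArg (fun μ : PosRadon => μ.1 univ) h1
  simp [PosRadon.val_zero, PosRadon.val_one] at h2

theorem ConcentratedOn.eq_zero {α : MPlus} {s t : Set ℝ} (hs : ConcentratedOn α s)
    (ht : ConcentratedOn α t) (hst : Disjoint s t) : α = 0 := by
  obtain ⟨μ, ν, rfl, hμ, hν⟩ := ht
  have key : ∀ μ : PosRadon, μ.1 tᶜ = 0 → μ.restrict s = 0 := fun μ h =>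
    PosRadon.ext (Measure.restrict_eq_zero.2 (measure_mono_null hst.subset_compl_right h))
  rw [hs.mk_restrict, key μ hμ, key ν hν, zero_def]

theorem l_nonpos {α : MPlus} (h : ConcentratedOn α (Iic 0)) (h0 : α ≠ 0) : α.l ≤ 0 := by
  by_contra! hlt
  obtain ⟨c, hc0, hc⟩ := EReal.lt_iff_exists_real_btwn.1 hlt
  refine h0 (h.eq_zero (concentratedOn_Ici hc.le) (disjoint_left.2 fun x hx hx' => ?_))
  exact absurd (EReal.coe_pos.1 hc0) (not_lt.2 (le_trans hx' hx))

end MPlus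
-- Local `L^p` densities and their stability under convolution.
namespace PosRadon

/-- `μ` has a density whose `p`-th power is integrable on every half-line bounded above. -/
def HasLpDensity (p : ℝ) (μ : PosRadon) : Prop :=
  ∃ F : ℝ → ℝ≥0∞, Measurable F ∧ μ.1 = volume.withDensity F ∧
    ∀ c : ℝ, ∫⁻ t in Iic c, F t ^ p < ∞

theorem HasLpDensity.exists_eq_zero_off {p : ℝ} (hp : 1 ≤ p) {μ : PosRadon}
    (h : μ.HasLpDensity p) {s : Set ℝ} (hs : MeasurableSet s) :
    ∃ F : ℝ → ℝ≥0∞, Measurable F ∧ (μ.restrict s).1 = volume.withDensity F ∧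
      (∀ c : ℝ, ∫⁻ t in Iic c, F t ^ p < ∞) ∧ ∀ t ∉ s, F t = 0 := by
  obtain ⟨F, hF, hμ, hint⟩ := h
  refine ⟨s.indicator F, hF.indicator hs, ?_, fun c => (lintegral_mono fun t => ?_).trans_lt
    (hint c), fun t ht => indicator_of_notMem ht F⟩
  · rw [val_restrict, hμ, restrict_withDensity hs, withDensity_indicator hs]
  · exact ENNReal.rpow_le_rpow (indicator_le_self s F t) (by linarith)

theorem HasLpDensity.restrict {p : ℝ} (hp : 1 ≤ p) {μ : PosRadon} (h : μ.HasLpDensity p)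
    {s : Set ℝ} (hs : MeasurableSet s) : (μ.restrict s).HasLpDensity p := by
  obtain ⟨F, hF, hμ, hint, -⟩ := h.exists_eq_zero_off hp hs
  exact ⟨F, hF, hμ, hint⟩

theorem HasLpDensity.add {p : ℝ} (hp : 1 ≤ p) {μ ν : PosRadon} (hμ : μ.HasLpDensity p)
    (hν : ν.HasLpDensity p) : (μ + ν).HasLpDensity p := by
  obtain ⟨F, hF, hμ, hFi⟩ := hμ
  obtain ⟨G, hG, hν, hGi⟩ := hν
  refine ⟨F + G, hF.add hG, ?_, fun c => ?_⟩
  · rw [val_add, hμ, hν, withDensity_add_left hF]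
  · exact ENNReal.lintegral_rpow_add_lt_top_of_lintegral_rpow_lt_top hF.aemeasurable
      (hFi c) (hGi c) hp

/-- Tonelli together with translation invariance of Lebesgue measure. -/
theorem conv_withDensity (ν : Measure ℝ) [SFinite ν] {F : ℝ → ℝ≥0∞} (hF : Measurable F) :
    ν.conv (volume.withDensity F) = volume.withDensity fun t => ∫⁻ s, F (t - s) ∂ν := by
  have hm : Measurable fun x : ℝ × ℝ => F (x.1 - x.2) := by fun_prop
  ext B hB
  have hi : Measurable (B.indicator (1 : ℝ → ℝ≥0∞)) := measurable_one.indicator hB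
  have hshift : ∀ x : ℝ, ∫⁻ y, B.indicator (1 : ℝ → ℝ≥0∞) (x + y) ∂(volume.withDensity F)
      = ∫⁻ t, F (t - x) * B.indicator 1 t := fun x => by
    rw [lintegral_withDensity_eq_lintegral_mul _ hF (by fun_prop),
      ← lintegral_add_left_eq_self (fun t => F (t - x) * B.indicator 1 t) x]
    simp only [Pi.mul_apply, add_sub_cancel_left]
  rw [withDensity_apply _ hB, ← lintegral_indicator_one hB, Measure.lintegral_conv hi]
  simp_rw [hshift]
  rw [lintegral_lintegral_swap (by fun_prop), ← lintegral_indicator hB]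
  refine lintegral_congr fun t => ?_
  rw [lintegral_mul_const _ (by fun_prop)]
  by_cases ht : t ∈ B <;> simp [ht]

theorem lintegral_rpow_le {α : Type*} [MeasurableSpace α] {p : ℝ} (hp : 1 ≤ p) (ν : Measure α)
    {F : α → ℝ≥0∞} (hF : Measurable F) :
    (∫⁻ s, F s ∂ν) ^ p ≤ (∫⁻ s, F s ^ p ∂ν) * ν univ ^ (p - 1) := by
  have hp0 : 0 < p := by linarith
  have h := eLpNorm'_le_eLpNorm'_mul_rpow_measure_univ one_pos hp
    hF.aestronglyMeasurable (μ := ν)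
  simp only [eLpNorm', enorm_eq_self, ENNReal.rpow_one, div_one] at h
  refine (ENNReal.rpow_le_rpow h hp0.le).trans_eq ?_
  rw [ENNReal.mul_rpow_of_nonneg _ _ hp0.le, ← ENNReal.rpow_mul, ← ENNReal.rpow_mul,
    one_div_mul_cancel hp0.ne', ENNReal.rpow_one]
  congr 2
  field_simp

/-- A local form of Young's inequality: supports bounded on the left make only a part of `ν` of
finite mass matter for `t ≤ c`, and Hölder plus Tonelli then bound the norm. -/
theorem HasLpDensity.mul {p : ℝ} (hp : 1 ≤ p) (ν : PosRadon) {μ : PosRadon}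
    (hμ : μ.HasLpDensity p) : (ν * μ).HasLpDensity p := by
  have hp0 : 0 < p := by linarith
  obtain ⟨b, hb⟩ := μ.bddLeft
  obtain ⟨a, ha⟩ := ν.bddLeft
  obtain ⟨F, hF, hμF, hFi, hF0⟩ := hμ.exists_eq_zero_off hp (measurableSet_Ici (a := b))
  rw [restrict_eq_self (by rwa [compl_Ici])] at hμF
  refine ⟨fun t => ∫⁻ s, F (t - s) ∂ν.1, ?_, ?_, fun c => ?_⟩
  · exact Measurable.lintegral_prod_right' (f := fun x : ℝ × ℝ => F (x.1 - x.2)) (by fun_prop)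
  · rw [val_mul, hμF, conv_withDensity _ hF]
  -- If `t ≤ c` and `F (t - s) ≠ 0`, then `t - s ≥ b`, so `s ≤ c - b`.
  set ν' := ν.1.restrict (Iic (c - b)) with hν'
  have hfin : ν' univ < ∞ := by rw [hν', Measure.restrict_apply_univ]; exact ν.Iic_lt_top _
  have hae : ∀ᵐ s ∂ν', a ≤ s := by
    refine ae_restrict_of_ae (mem_ae_iff.2 ?_)
    change ν.1 (Ici a)ᶜ = 0
    rwa [compl_Ici]
  have h1 : ∀ t ∈ Iic c, (∫⁻ s, F (t - s) ∂ν.1) ^ p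
      ≤ (∫⁻ s, F (t - s) ^ p ∂ν') * ν' univ ^ (p - 1) := fun t ht => by
    have : ∫⁻ s, F (t - s) ∂ν.1 = ∫⁻ s, F (t - s) ∂ν' := by
      rw [hν', setLIntegral_eq_of_support_subset]
      intro s hs
      by_contra hc
      refine hs (hF0 _ fun h => hc ?_)
      simp only [mem_Iic, mem_Ici] at *
      linarith
    rw [this]
    exact lintegral_rpow_le hp ν' (by fun_prop)
  have h2 : ∀ s, a ≤ s → ∫⁻ t in Iic c, F (t - s) ^ p ≤ ∫⁻ t in Iic (c - a), F t ^ p :=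
    fun s hs => by
    rw [← lintegral_indicator measurableSet_Iic, ← lintegral_indicator measurableSet_Iic,
      ← lintegral_add_right_eq_self _ s]
    refine lintegral_mono fun t => ?_
    by_cases ht : t + s ≤ c
    · rw [indicator_of_mem (mem_Iic.2 ht), indicator_of_mem (mem_Iic.2 (by linarith)),
        add_sub_cancel_right]
    · rw [indicator_of_notMem (by simpa using ht)]
      exact zero_le
  calc ∫⁻ t in Iic c, (∫⁻ s, F (t - s) ∂ν.1) ^ p
      ≤ ∫⁻ t in Iic c, (∫⁻ s, F (t - s) ^ p ∂ν') * ν' univ ^ (p - 1) :=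
        setLIntegral_mono' measurableSet_Iic h1
    _ = (∫⁻ s, (∫⁻ t in Iic c, F (t - s) ^ p) ∂ν') * ν' univ ^ (p - 1) := by
        rw [lintegral_mul_const' _ _
          (ENNReal.rpow_lt_top_of_nonneg (by linarith) hfin.ne).ne,
          lintegral_lintegral_swap (by fun_prop)]
    _ ≤ (∫⁻ _, (∫⁻ t in Iic (c - a), F t ^ p) ∂ν') * ν' univ ^ (p - 1) := by
        gcongr ?_ * _
        exact lintegral_mono_ae (hae.mono h2)
    _ < ∞ := by
        rw [lintegral_const]
        exact ENNReal.mul_lt_top (ENNReal.mul_lt_top (hFi _) hfin)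
          (ENNReal.rpow_lt_top_of_nonneg (by linarith) hfin.ne)

theorem HasLpDensity.exists_memLp {q : ℝ≥0∞} (hq1 : 1 ≤ q) (hq : q ≠ ∞) {μ : PosRadon}
    (h : μ.HasLpDensity q.toReal) {s : Set ℝ} (hs : MeasurableSet s) {c : ℝ} (hc : s ⊆ Iic c) :
    ∃ F : ℝ → ℝ≥0∞, Measurable F ∧ (μ.restrict s).1 = volume.withDensity F ∧
      MemLp (fun t => (F t).toReal) q volume ∧ (∀ᵐ t : ℝ, F t < ∞) ∧ ∀ t ∉ s, F t = 0 := by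
  have hp : 1 ≤ q.toReal := by
    rwa [← ENNReal.toReal_one, ENNReal.toReal_le_toReal ENNReal.one_ne_top hq]
  have hp0 : 0 < q.toReal := by linarith
  obtain ⟨F, hF, hμ, hi, h0⟩ := h.exists_eq_zero_off hp hs
  have hlt : ∫⁻ t, F t ^ q.toReal < ∞ := by
    rw [← setLIntegral_eq_of_support_subset (s := Iic c)]
    · exact hi c
    · intro t ht
      by_contra hcon
      exact ht (by simp only [h0 t fun hts => hcon (hc hts), ENNReal.zero_rpow_of_pos hp0])
  refine ⟨F, hF, hμ, ⟨hF.ennreal_toReal.aestronglyMeasurable, ?_⟩, ?_, h0⟩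
  · rw [eLpNorm_lt_top_iff_lintegral_rpow_enorm_lt_top (by positivity) hq]
    refine (lintegral_mono fun t => ?_).trans_lt hlt
    refine ENNReal.rpow_le_rpow ?_ hp0.le
    rw [Real.enorm_eq_ofReal ENNReal.toReal_nonneg]
    exact ENNReal.ofReal_toReal_le
  · filter_upwards [ae_lt_top (hF.pow_const _) hlt.ne] with t ht
    by_contra hcon
    rw [not_lt_top_iff.1 hcon, ENNReal.top_rpow_of_pos hp0] at ht
    exact lt_irrefl _ ht

end PosRadon

/-! ### Densities of signed measures and the passage between functions and measures. -/

namespace MPlus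

/-- `α` is a difference of positive Radon measures with `L^p` densities. -/
def HasLpDensity (p : ℝ) (α : MPlus) : Prop :=
  ∃ μ ν : PosRadon, α = mk μ ν ∧ μ.HasLpDensity p ∧ ν.HasLpDensity p

theorem HasLpDensity.mul {p : ℝ} (hp : 1 ≤ p) (α : MPlus) {β : MPlus} (hβ : β.HasLpDensity p) :
    (α * β).HasLpDensity p := by
  induction α using ind with | _ a b
  obtain ⟨μ, ν, rfl, hμ, hν⟩ := hβ
  exact ⟨_, _, mk_mul_mk _ _ _ _, (hμ.mul hp a).add hp (hν.mul hp b),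
    (hν.mul hp a).add hp (hμ.mul hp b)⟩

theorem HasLpDensity.exists_add {p : ℝ} (hp : 1 ≤ p) {α : MPlus} (h : α.HasLpDensity p)
    {s : Set ℝ} (hs : MeasurableSet s) :
    ∃ β γ : MPlus, α = β + γ ∧ β.ConcentratedOn s ∧ γ.ConcentratedOn sᶜ ∧ γ.HasLpDensity p := by
  obtain ⟨μ, ν, rfl, hμ, hν⟩ := h
  refine ⟨mk (μ.restrict s) (ν.restrict s), mk (μ.restrict sᶜ) (ν.restrict sᶜ), ?_,
    ⟨_, _, rfl, μ.restrict_null hs, ν.restrict_null hs⟩,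
    ⟨_, _, rfl, μ.restrict_null hs.compl, ν.restrict_null hs.compl⟩,
    ⟨_, _, rfl, hμ.restrict hp hs.compl, hν.restrict hp hs.compl⟩⟩
  rw [mk_add_mk, μ.restrict_add_restrict_compl hs, ν.restrict_add_restrict_compl hs]

end MPlus

theorem concentratedOn_ofFun {f : ℝ → ℝ} (hf : LocallyIntegrable f volume)
    (ha : ∃ a : ℝ, ∀ᵐ t : ℝ, t < a → f t = 0) {s : Set ℝ} (hs : MeasurableSet s)
    (h : ∀ᵐ t : ℝ, t ∉ s → f t = 0) : (ofFun f hf ha).ConcentratedOn s := by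
  refine ⟨_, _, rfl, ?_, ?_⟩
  · change volume.withDensity (fun t => ENNReal.ofReal (f t)) sᶜ = 0
    rw [withDensity_apply _ hs.compl]
    refine lintegral_eq_zero_of_ae_eq_zero ((ae_restrict_iff' hs.compl).2 ?_)
    filter_upwards [h] with t ht hts
    simp [ht hts]
  · change volume.withDensity (fun t => ENNReal.ofReal (-f t)) sᶜ = 0
    rw [withDensity_apply _ hs.compl]
    refine lintegral_eq_zero_of_ae_eq_zero ((ae_restrict_iff' hs.compl).2 ?_)
    filter_upwards [h] with t ht hts
    simp [ht hts]

theorem hasLpDensity_posDensity {q : ℝ≥0∞} (hq1 : 1 ≤ q) (hq : q ≠ ∞) {f : ℝ → ℝ}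
    (hf : LocallyIntegrable f volume) (ha : ∃ a : ℝ, ∀ᵐ t : ℝ, t < a → f t = 0)
    (hfq : MemLp f q volume) : (posDensity f hf ha).HasLpDensity q.toReal := by
  have hq0 : q ≠ 0 := (one_pos.trans_le hq1).ne'
  have hlt := (eLpNorm_lt_top_iff_lintegral_rpow_enorm_lt_top hq0 hq).1 hfq.2
  have hm := hfq.1.aemeasurable
  refine ⟨fun t => ENNReal.ofReal (hm.mk f t), hm.measurable_mk.ennreal_ofReal,
    withDensity_congr_ae ?_, fun c => ?_⟩
  · filter_upwards [hm.ae_eq_mk] with t ht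
    rw [ht]
  · refine ((setLIntegral_le_lintegral _ _).trans (lintegral_mono_ae ?_)).trans_lt hlt
    filter_upwards [hm.ae_eq_mk] with t ht
    rw [← ht]
    exact ENNReal.rpow_le_rpow (Real.ofReal_le_enorm _) ENNReal.toReal_nonneg

/-- Identifies `F dt - G dt` with the measure of the function `F - G`, which `ofFun` represents by
positive and negative parts. -/
theorem ofReal_sub_add_ofReal {a b : ℝ} (ha : 0 ≤ a) (hb : 0 ≤ b) :
    ENNReal.ofReal (a - b) + ENNReal.ofReal b = ENNReal.ofReal a + ENNReal.ofReal (-(a - b)) := by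
  rcases le_total a b with h | h
  · rw [ENNReal.ofReal_of_nonpos (sub_nonpos.2 h), zero_add,
      ← ENNReal.ofReal_add ha (by linarith)]
    congr 1; ring
  · rw [ENNReal.ofReal_of_nonpos (neg_nonpos.2 (sub_nonneg.2 h)), add_zero,
      ← ENNReal.ofReal_add (sub_nonneg.2 h) hb, sub_add_cancel]

namespace InputFn

variable {q : ℝ≥0∞} [hq1 : Fact (1 ≤ q)]

theorem hasLpDensity_toMPlus (hq : q ≠ ∞) (u : InputFn q) : u.toMPlus.HasLpDensity q.toReal :=
  ⟨_, _, rfl, hasLpDensity_posDensity hq1.out hq _ _ u.memLp,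
    hasLpDensity_posDensity hq1.out hq _ _ u.memLp.neg⟩

theorem concentratedOn_toMPlus (u : InputFn q) : u.toMPlus.ConcentratedOn (Iic 0) := by
  obtain ⟨N, hN⟩ := u.supported
  exact concentratedOn_ofFun _ _ measurableSet_Iic
    (hN.mono fun t ht hts => ht fun h => hts h.2)

theorem exists_toMPlus_eq (hq : q ≠ ∞) {α : MPlus} (hα : α.HasLpDensity q.toReal) {T : ℝ}
    (h0 : α.ConcentratedOn (Iic 0)) (hT : α.ConcentratedOn (Ici (-T))) :
    ∃ u : InputFn q, u.SupportedIn T ∧ u.toMPlus = α := by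
  have hp : 1 ≤ q.toReal := by
    rw [← ENNReal.toReal_one, ENNReal.toReal_le_toReal ENNReal.one_ne_top hq]; exact hq1.out
  obtain ⟨μ, ν, rfl, hμ, hν⟩ := hα
  have hs : MeasurableSet (Icc (-T) 0) := measurableSet_Icc
  have hr : ∀ μ : PosRadon, (μ.restrict (Ici (-T))).restrict (Iic 0) = μ.restrict (Icc (-T) 0) :=
    fun μ => PosRadon.ext (by
      rw [PosRadon.val_restrict, PosRadon.val_restrict, Measure.restrict_restrict measurableSet_Iic,
        inter_comm, Ici_inter_Iic, PosRadon.val_restrict])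
  have hα : MPlus.mk μ ν = MPlus.mk (μ.restrict (Icc (-T) 0)) (ν.restrict (Icc (-T) 0)) := by
    have h0' := h0
    rw [hT.mk_restrict] at h0'
    rw [← hr, ← hr, ← h0'.mk_restrict, ← hT.mk_restrict]
  obtain ⟨F, hF, hμF, hFq, hFt, hF0⟩ := hμ.exists_memLp hq1.out hq hs Icc_subset_Iic_self
  obtain ⟨G, hG, hνG, hGq, hGt, hG0⟩ := hν.exists_memLp hq1.out hq hs Icc_subset_Iic_self
  have hz : ∀ t ∉ Icc (-T) 0, (F t).toReal - (G t).toReal = 0 := fun t ht => by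
    simp [hF0 t ht, hG0 t ht]
  -- The field `supported` asks for an integer bound, hence the ceiling of `T`.
  refine ⟨⟨fun t => (F t).toReal - (G t).toReal, hFq.sub hGq, ⌈T⌉₊,
    Eventually.of_forall fun t ht => hz t fun h => ht ⟨?_, h.2⟩⟩,
    Eventually.of_forall hz, ?_⟩
  · linarith [h.1, Nat.le_ceil T]
  · rw [hα]
    refine MPlus.mk_eq (PosRadon.ext ?_)
    rw [PosRadon.val_add, PosRadon.val_add, hμF, hνG]
    change volume.withDensity (fun t => ENNReal.ofReal ((F t).toReal - (G t).toReal)) + _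
      = _ + volume.withDensity (fun t => ENNReal.ofReal (-((F t).toReal - (G t).toReal)))
    rw [← withDensity_add_right _ hG, ← withDensity_add_left hF]
    refine withDensity_congr_ae ?_
    filter_upwards [hFt, hGt] with t h1 h2
    have := ofReal_sub_add_ofReal (F t).toReal_nonneg (G t).toReal_nonneg
    rwa [ENNReal.ofReal_toReal h1.ne, ENNReal.ofReal_toReal h2.ne] at this

end InputFn

/-! ### Determinants and adjugates over a subring. -/

theorem det_mem_of_mem {R : Type*} [CommRing R] (N : Subring R) {n : Type*} [Fintype n]
    [DecidableEq n] {M : Matrix n n R} (h : ∀ i j, M i j ∈ N) : M.det ∈ N := by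
  rw [Matrix.det_apply]
  refine sum_mem fun σ _ => ?_
  rw [Units.smul_def]
  exact zsmul_mem (prod_mem fun i _ => h _ _) _

theorem adjugate_mem_of_mem {R : Type*} [CommRing R] (N : Subring R) {n : Type*} [Fintype n]
    [DecidableEq n] {M : Matrix n n R} (h : ∀ i j, M i j ∈ N) (i j : n) : M.adjugate i j ∈ N := by
  rw [Matrix.adjugate_apply]
  refine det_mem_of_mem N fun k l => ?_
  rw [Matrix.updateRow_apply]
  split_ifs
  · rw [Pi.single_apply]
    split_ifs
    exacts [one_mem _, zero_mem _]
  · exact h k l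

/-! ### Division by `det Q` and reachability in bounded time. -/

namespace System

variable {d m : ℕ} (S : System d m)

theorem Q_mem_nonposSubring (i j : Fin d) : S.Q i j ∈ MPlus.nonposSubring :=
  MPlus.concentratedOn_of_supp_subset isClosed_Iic (S.Q_mem i j).2

theorem P_mem_nonposSubring (i : Fin d) (j : Fin m) : S.P i j ∈ MPlus.nonposSubring :=
  MPlus.concentratedOn_of_supp_subset isClosed_Iic (S.P_mem i j).2

theorem det_mul_det_Qinv : S.Q.det * S.Qinv.det = 1 := by
  rw [← Matrix.det_mul, S.mul_Qinv, Matrix.det_one]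

theorem l_det_nonpos : S.Q.det.l ≤ 0 :=
  MPlus.l_nonpos (det_mem_of_mem _ S.Q_mem_nonposSubring)
    (left_ne_zero_of_mul_eq_one S.det_mul_det_Qinv)

/-- Cramer's rule: `det Q` clears the denominator of the impulse response, leaving entries carried
by `(-∞, 0]`. -/
theorem det_smul_A : S.Q.det • S.A = S.Q.adjugate * S.P := by
  have h : S.Q.det • S.Qinv = S.Q.adjugate := by
    rw [← Matrix.one_mul S.Q.adjugate, ← S.Qinv_mul, Matrix.mul_assoc, Matrix.mul_adjugate,
      Matrix.mul_smul, Matrix.mul_one]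
  rw [A, ← Matrix.smul_mul, h]

theorem adjugate_mul_P_mem (i : Fin d) (j : Fin m) :
    (S.Q.adjugate * S.P) i j ∈ MPlus.nonposSubring := by
  rw [Matrix.mul_apply]
  exact sum_mem fun k _ =>
    mul_mem (adjugate_mem_of_mem _ S.Q_mem_nonposSubring i k) (S.P_mem_nonposSubring k j)

variable {q : ℝ≥0∞} [hq1 : Fact (1 ≤ q)]

/-- Euclidean division of an input by the determinant of `Q`. -/
theorem exists_eq_det_mul_add (hq : q ≠ ∞) {T : ℝ} (hT : -(S.Q.det.l) < (T : EReal))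
    (u : InputFn q) : ∃ (v : MPlus) (u' : InputFn q), v ∈ MPlus.nonposSubring ∧
      u'.SupportedIn T ∧ u.toMPlus = S.Q.det * v + u'.toMPlus := by
  have hp : 1 ≤ q.toReal := by
    rw [← ENNReal.toReal_one, ENNReal.toReal_le_toReal ENNReal.one_ne_top hq]; exact hq1.out
  obtain ⟨v, r, hw, hv, hr, hrp⟩ :=
    ((u.hasLpDensity_toMPlus hq).mul hp S.Qinv.det).exists_add hp
      (measurableSet_Iic (a := (0 : ℝ)))
  have hu : u.toMPlus = S.Q.det * v + S.Q.det * r := by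
    rw [← mul_add, ← hw, ← mul_assoc, S.det_mul_det_Qinv, one_mul]
  have hD : S.Q.det ∈ MPlus.nonposSubring := det_mem_of_mem _ S.Q_mem_nonposSubring
  -- Although `r` lives on `(0, ∞)`, this product is the difference of `u` and `det Q * v`, both
  -- carried by `(-∞, 0]`.
  have h0 : S.Q.det * r ∈ MPlus.nonposSubring := by
    rw [← sub_eq_iff_eq_add'.2 hu]
    exact sub_mem (MPlus.mem_nonposSubring.2 u.concentratedOn_toMPlus) (mul_mem hD hv)
  have hl : ((-T : ℝ) : EReal) ≤ S.Q.det.l := by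
    rw [EReal.coe_neg]; exact (EReal.neg_lt_comm.1 hT).le
  have hTc : (S.Q.det * r).ConcentratedOn (Ici (-T)) :=
    (MPlus.concentratedOn_Ici hl).mul hr measurableSet_Ici fun x hx y hy => by
      simp only [mem_Ici, mem_compl_iff, mem_Iic, not_le] at *
      linarith
  obtain ⟨u', hu', he⟩ := InputFn.exists_toMPlus_eq hq (hrp.mul hp S.Q.det) h0 hTc
  exact ⟨v, u', hv, hu', he ▸ hu⟩

/-- Every output is also produced by an input supported in `[-T, 0]`. -/
theorem exists_supportedIn_isOutput (hq : q ≠ ∞) {T : ℝ} (hT : -(S.Q.det.l) < (T : EReal))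
    (u : Fin m → InputFn q) : ∃ u' : Fin m → InputFn q, (∀ j, (u' j).SupportedIn T) ∧
      ∀ y : Fin d → OutputFn q, S.IsOutput u y → S.IsOutput u' y := by
  choose v u' hv hu' he using fun j => S.exists_eq_det_mul_add hq hT (u j)
  refine ⟨u', hu', fun y hy i => MPlus.PiEq.of_sub_concentratedOn ?_ (hy i)⟩
  have h1 : (fun j => (u j).toMPlus) = S.Q.det • v + fun j => (u' j).toMPlus :=
    funext he
  -- The scalar `det Q` moves from `v` onto `A`, where it turns `A` into `adj(Q) * P`.
  have h2 : S.A.mulVec (fun j => (u' j).toMPlus) i - S.A.mulVec (fun j => (u j).toMPlus) i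
      = -(S.Q.adjugate * S.P).mulVec v i := by
    rw [h1, Matrix.mulVec_add, Matrix.mulVec_smul, ← Matrix.smul_mulVec, det_smul_A,
      Pi.add_apply]
    ring
  rw [h2, Matrix.mulVec, dotProduct]
  exact MPlus.nonposSubring.neg_mem
    (sum_mem fun j _ => mul_mem (S.adjugate_mul_P_mem i j) (hv j))

/-- The outputs `z n` are unchanged when the inputs are replaced, so convergence is inherited. -/
theorem QuasiReachable.quasiReachableIn {S : System d m} (h : S.QuasiReachable q) (hq : q ≠ ∞)
    {T : ℝ} (hT : -(S.Q.det.l) < (T : EReal)) : S.QuasiReachableIn q T := by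
  intro y hy
  obtain ⟨u, z, hu, hz⟩ := h y hy
  choose u' hu' ho using fun n => S.exists_supportedIn_isOutput hq hT (u n)
  exact ⟨u', z, hu', fun n => ho n _ (hu n), hz⟩

theorem Reachable.reachableIn {S : System d m} (h : S.Reachable q) (hq : q ≠ ∞)
    {T : ℝ} (hT : -(S.Q.det.l) < (T : EReal)) : S.ReachableIn q T := by
  intro y hy
  obtain ⟨u, hu⟩ := h y hy
  obtain ⟨u', hu', ho⟩ := S.exists_supportedIn_isOutput hq hT u
  exact ⟨u', hu', ho _ hu⟩

theorem exists_neg_l_det_lt : ∃ T : ℝ, -(S.Q.det.l) < (T : EReal) := by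
  have h : -(S.Q.det.l) < ⊤ := by
    rw [lt_top_iff_ne_top, ne_eq, EReal.neg_eq_top_iff]
    exact MPlus.l_ne_bot _
  obtain ⟨T, hT, -⟩ := EReal.lt_iff_exists_real_btwn.1 h
  exact ⟨T, hT⟩

/-- Since `l(det Q) ≤ 0`, every `T > -l(det Q)` is positive and so is admissible in the infimum. -/
theorem iInf_le_neg_l_det {p : ℝ → Prop} (h : ∀ T : ℝ, -(S.Q.det.l) < (T : EReal) → p T) :
    ⨅ (T : ℝ) (_ : 0 < T ∧ p T), (T : EReal) ≤ -(S.Q.det.l) := by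
  refine le_of_forall_gt fun c hc => ?_
  obtain ⟨T, hT, hTc⟩ := EReal.lt_iff_exists_real_btwn.1 hc
  have h0 : (0 : EReal) ≤ -(S.Q.det.l) := EReal.neg_nonneg.2 S.l_det_nonpos
  exact (iInf₂_le T ⟨EReal.coe_pos.1 (h0.trans_lt hT), h T hT⟩).trans_lt hTc

end System

end PseudoRational

theorem theorem1 {d m : ℕ} (S : PseudoRational.System d m) (q : ℝ≥0∞) [Fact (1 ≤ q)]
    (hq : q ≠ ∞) :
    (S.QuasiReachable q ↔ ∀ T : ℝ, -(S.Q.det.l) < (T : EReal) → S.QuasiReachableIn q T) ∧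
    (S.Reachable q ↔ ∀ T : ℝ, -(S.Q.det.l) < (T : EReal) → S.ReachableIn q T) ∧
    (S.QuasiReachable q → S.quasiReachableMinTime q ≤ -(S.Q.det.l)) ∧
    (S.Reachable q → S.reachableMinTime q ≤ -(S.Q.det.l)) := by
  obtain ⟨T, hT⟩ := S.exists_neg_l_det_lt
  refine ⟨⟨fun h T hT => h.quasiReachableIn hq hT, fun h y hy => ?_⟩,
    ⟨fun h T hT => h.reachableIn hq hT, fun h y hy => ?_⟩,
    fun h => S.iInf_le_neg_l_det fun T hT => h.quasiReachableIn hq hT,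
    fun h => S.iInf_le_neg_l_det fun T hT => h.reachableIn hq hT⟩
  · obtain ⟨u, z, -, hu⟩ := h T hT y hy
    exact ⟨u, z, hu⟩
  · obtain ⟨u, -, hu⟩ := h T hT y hy
    exact ⟨u, hu⟩
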